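/- Let $n\ge 0$. To an integer partition $\mu$ of $n$ into parts congruent to $1$ or $4$ modulo $5$ associate the multiset of pairs $(j,5k)$, one pair for each part $5k+j$ of $\mu$ ($k\ge 0$, $j\in\{1,4\}$), and apply to it the Robinson--Schensted--Knuth correspondence: list the pairs in weakly increasing lexicographic order and, starting with $P=Q=\varnothing$, for each pair $(j,x)$ in turn row-insert $x$ into $P$ and place $j$ in $Q$ in the cell that has been added to the shape of $P$. (To row-insert $x$, replace the leftmost entry greater than $x$ in the first row by $x$ and insert the replaced entry in the same way into the next row, and so on; when a row has no entry greater than the one to be inserted, this one is put at the end of that row and the insertion stops.) The map $\mu\mapsto(P,Q)$ is a bijection between 1. the integer partitions of $n$ into parts congruent to $1$ or $4$ modulo $5$, and 2. the pairs $(P,Q)$ of column strict tableaux (entries weakly increasing along rows, strictly increasing down columns) of the same shape with at most two rows, possibly empty, such that every entry of $P$ is a nonnegative integer congruent to $0$ modulo $5$ (the entry $0$ is allowed), every entry of $Q$ is $1$ or $4$, and the sum of all entries of $P$ and $Q$ is $n$. -/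

import Mathlib

/-! The Robinson--Schensted--Knuth correspondence. The algorithm works on tableaux written as
lists of rows, top row first, each row read from left to right. -/

namespace RSK

/-- Row insertion of `x` into one row: the leftmost entry that is greater than `x` is replaced
by `x` and bumped out (it is returned as `some`); if there is no such entry, then `x` is put at
the end of the row and nothing is bumped. -/
def rowInsert (x : ℕ) : List ℕ → List ℕ × Option ℕ
  | [] => ([x], none)
  | y :: r =>
    if x < y then (x :: r, some y)
    else (y :: (rowInsert x r).1, (rowInsert x r).2)

/-- Row insertion of `x` into a tableau: insert `x` into the first row, the bumped entry into the
second row, and so on, until nothing is bumped. The second component is the index (from `0`)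
of the row in which the procedure ends, that is, of the row that gained a cell. -/
def tableauInsert : ℕ → List (List ℕ) → List (List ℕ) × ℕ
  | x, [] => ([[x]], 0)
  | x, r :: T =>
    match rowInsert x r with
    | (r', none) => (r' :: T, 0)
    | (r', some y) => (r' :: (tableauInsert y T).1, (tableauInsert y T).2 + 1)

/-- Add a cell with entry `y` at the end of the row with index `i`
(as a new last row if there is no such row). -/
def addCell (y : ℕ) : ℕ → List (List ℕ) → List (List ℕ)
  | _, [] => [[y]]
  | 0, r :: T => (r ++ [y]) :: T
  | i + 1, r :: T => r :: addCell y i T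

/-- One step for the biletter with top `b.1` and bottom `b.2`: insert the bottom letter into `P`
and record the top letter in `Q`, in the cell by which the shape of `P` has grown. -/
def step (PQ : List (List ℕ) × List (List ℕ)) (b : ℕ × ℕ) :
    List (List ℕ) × List (List ℕ) :=
  ((tableauInsert b.2 PQ.1).1, addCell b.1 (tableauInsert b.2 PQ.1).2 PQ.2)

/-- The Robinson--Schensted--Knuth algorithm on a finite multiset of biletters `(top, bottom)`
(equivalently, a finitely supported matrix of natural numbers): the biletters are read in weakly
increasing lexicographic order, starting with the pair of empty tableaux. -/
def rsk (s : Multiset (ℕ ×ₗ ℕ)) : List (List ℕ) × List (List ℕ) :=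
  ((s.sort (· ≤ ·)).map ofLex).foldl step ([], [])

/-- The list of rows of a column strict (that is, semistandard) tableau. -/
def rows {μ : YoungDiagram} (T : SemistandardYoungTableau μ) : List (List ℕ) :=
  (List.range (μ.colLen 0)).map fun i => (List.range (μ.rowLen i)).map fun j => T i j

/-- The biletters of a partition: the part `m = 5 * k + j` with `0 ≤ j < 5` gives the biletter
with top `j` and bottom `5 * k`. -/
def biletters {n : ℕ} (p : n.Partition) : Multiset (ℕ ×ₗ ℕ) :=
  p.parts.map fun m => toLex (m % 5, 5 * (m / 5))

/-- Partitions of `n` into parts congruent to `1` or `4` modulo `5`. -/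
def Partitions14 (n : ℕ) : Type :=
  {p : n.Partition // ∀ m ∈ p.parts, m ≡ 1 [MOD 5] ∨ m ≡ 4 [MOD 5]}

/-- Pairs `(P, Q)` of column strict tableaux of the same shape `μ` with at most two rows, where
the entries of `P` are congruent to `0` modulo `5` (the entry `0` is allowed), the entries of `Q`
are `1` or `4`, and the sum of all entries of `P` and `Q` is `n`. -/
structure TableauPair (n : ℕ) where
  μ : YoungDiagram
  P : SemistandardYoungTableau μ
  Q : SemistandardYoungTableau μ
  at_most_two_rows : μ.colLen 0 ≤ 2
  P_entries : ∀ c ∈ μ.cells, P c.1 c.2 ≡ 0 [MOD 5]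
  Q_entries : ∀ c ∈ μ.cells, Q c.1 c.2 = 1 ∨ Q c.1 c.2 = 4
  sum_entries : ∑ c ∈ μ.cells, P c.1 c.2 + ∑ c ∈ μ.cells, Q c.1 c.2 = n

end RSK

/-! Only the tops 1 and 4 occur, so the sorted two-line array is a weakly increasing word `a` under
1's followed by a weakly increasing word `b` under 4's. Inserting `a` produces a single row. While
`b` is inserted, the bumped entries are themselves weakly increasing, so each lands at the end of
the second row and no third row arises; moreover, once a letter has been appended to the first row,
no later letter bumps. `Inserts` records this process, and `Inserts.foldl_step` identifies it with
the algorithm.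

Hence Q has first row 1…1 4…4 with |a| ones, and second row 4…4 of length at most |a|. Conversely,
column strictness forces every Q with entries 1 and 4 to look like this, so Q amounts to the number
|a| together with the shape.

Given P and |a|, the process can be undone: remove the entries of the first row beyond position |a|,
then let the entries of the second row, from the right, each displace the rightmost smaller entry of
the first row. This gives uniqueness (`Inserts.injective`) and existence
(`Inserts.exists_of_column_strict`). The sum is preserved because insertion permutes the letters and
a part is the sum of its biletter. -/

namespace RSK

/-- The relation between a row `a`, a weakly increasing list `b`, and the rows `r`, `s` of the
tableau obtained by row-inserting the entries of `b` into the one-row tableau `a`, provided that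
no entry of the second row is ever bumped. -/
inductive Inserts (a : List ℕ) : List ℕ → List ℕ → List ℕ → Prop
  | nil : Inserts a [] a []
  | append {b r s : List ℕ} {x : ℕ} : Inserts a b r s → (∀ z ∈ r, z ≤ x) → (∀ z ∈ b, z ≤ x) →
      Inserts a (b ++ [x]) (r ++ [x]) s
  | bump {b l₁ l₂ s : List ℕ} {x y : ℕ} : Inserts a b (l₁ ++ y :: l₂) s → (∀ z ∈ l₁, z ≤ x) →
      x < y → (∀ z ∈ b, z ≤ x) → Inserts a (b ++ [x]) (l₁ ++ x :: l₂) (s ++ [y])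

/-! ### Invariants of inserting a weakly increasing word into a row -/

namespace Inserts

variable {a b r s : List ℕ}

theorem perm (h : Inserts a b r s) : (r ++ s).Perm (a ++ b) := by
  induction h with
  | nil => simp
  | append _ _ _ ih =>
    rw [← Multiset.coe_eq_coe] at ih ⊢
    simp only [← Multiset.coe_add] at ih ⊢
    rw [← add_assoc, ← ih]; abel
  | bump _ _ _ _ ih =>
    rw [← Multiset.coe_eq_coe] at ih ⊢
    simp only [← Multiset.coe_add, ← Multiset.cons_coe, ← Multiset.singleton_add] at ih ⊢
    rw [← add_assoc (a : Multiset ℕ), ← ih]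
    abel

theorem length_add (h : Inserts a b r s) : r.length + s.length = a.length + b.length := by
  simpa using h.perm.length_eq

theorem length_le (h : Inserts a b r s) : a.length ≤ r.length := by
  induction h with
  | nil => rfl
  | append _ _ _ ih => simp; omega
  | bump _ _ _ _ ih => simpa using ih

theorem pairwise_letters (h : Inserts a b r s) : b.Pairwise (· ≤ ·) := by
  induction h with
  | nil => simp
  | append _ _ hb ih => simpa [List.pairwise_append, ih] using hb
  | bump _ _ _ hb ih => simpa [List.pairwise_append, ih] using hb

theorem pairwise_fst (h : Inserts a b r s) (ha : a.Pairwise (· ≤ ·)) : r.Pairwise (· ≤ ·) := by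
  induction h with
  | nil => exact ha
  | append _ hr _ ih => simpa [List.pairwise_append, ih] using hr
  | bump _ hl hxy _ ih =>
    simp only [List.pairwise_append, List.pairwise_cons, List.mem_cons] at ih ⊢
    refine ⟨ih.1, ⟨fun z hz => hxy.le.trans (ih.2.1.1 z hz), ih.2.1.2⟩, ?_⟩
    rintro u hu v (rfl | hv)
    · exact hl u hu
    · exact ih.2.2 u hu v (Or.inr hv)

/-- An appended letter dominates the row, and a bump afterwards would need an entry larger than the
current letter, hence larger than that dominating one. So bumps never follow appends. -/
theorem exists_max (h : Inserts a b r s) (hlt : a.length < r.length) :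
    ∃ u ∈ b, ∀ z ∈ r, z ≤ u := by
  induction h with
  | nil => exact absurd hlt (lt_irrefl _)
  | @append b r s x _ hr _ ih => exact ⟨x, by simp, by simpa [or_imp, forall_and] using hr⟩
  | @bump b l₁ l₂ s x y _ _ hxy hb ih =>
    obtain ⟨u, hu, hz⟩ := ih (by simpa using hlt)
    exact absurd (hz y (by simp)) (not_le.2 ((hb u hu).trans_lt hxy))

theorem length_eq_of_lt {x y : ℕ} (h : Inserts a b r s) (hb : ∀ z ∈ b, z ≤ x) (hy : y ∈ r)
    (hxy : x < y) : r.length = a.length := by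
  by_contra hne
  obtain ⟨u, hu, hz⟩ := h.exists_max (lt_of_le_of_ne h.length_le (Ne.symm hne))
  exact absurd (hz y hy) (not_le.2 ((hb u hu).trans_lt hxy))

theorem filter_le_eq {l₁ l₂ : List ℕ} {x y : ℕ} (h : (l₁ ++ y :: l₂).Pairwise (· ≤ ·))
    (hl : ∀ z ∈ l₁, z ≤ x) (hxy : x < y) :
    (l₁ ++ y :: l₂).filter (· ≤ x) = l₁ := by
  simp only [List.pairwise_append, List.pairwise_cons] at h
  rw [List.filter_append, List.filter_eq_self.2 (by simpa using hl), List.filter_eq_nil_iff.2]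
  · simp
  · intro z hz
    rcases List.mem_cons.1 hz with rfl | hz
    · simpa using hxy
    · simpa using hxy.trans_le (h.2.1.1 z hz)

theorem sublist_left {l₁ l₂ : List ℕ} {x y : ℕ} (h : (l₁ ++ y :: l₂).Pairwise (· ≤ ·))
    (hl : ∀ z ∈ l₁, z ≤ x) (hxy : x < y) (hb : ∀ z ∈ b, z ≤ x)
    (hs : b.Sublist (l₁ ++ y :: l₂)) : b.Sublist l₁ := by
  have := hs.filter (· ≤ x)
  rwa [filter_le_eq h hl hxy, List.filter_eq_self.2 (by simpa using hb)] at this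

/-- A bumped entry exceeds the current letter and hence all earlier ones, so inserted letters are
never bumped out. -/
theorem sublist (h : Inserts a b r s) (ha : a.Pairwise (· ≤ ·)) : b.Sublist r := by
  induction h with
  | nil => simp
  | append _ _ _ ih => exact ih.append (List.Sublist.refl _)
  | @bump b l₁ l₂ s x y h hl hxy hb ih =>
    refine (sublist_left (h.pairwise_fst ha) hl hxy hb ih).append ?_
    simp

theorem length_snd_le (h : Inserts a b r s) : s.length ≤ b.length := by
  have := h.length_add
  have := h.length_le
  omega

/-- After a bump the first row still has the length of `a` and contains all inserted letters, which
are at least as many as the bumped entries. In Q this puts every 4 of the second row below a 1. -/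
theorem length_snd_le_row (h : Inserts a b r s) (ha : a.Pairwise (· ≤ ·)) :
    s.length ≤ a.length := by
  induction h with
  | nil => simp
  | append _ _ _ ih => exact ih
  | @bump b l₁ l₂ s x y h hl hxy hb ih =>
    have h1 := h.length_eq_of_lt hb (y := y) (by simp) hxy
    have h2 := (h.bump hl hxy hb).length_snd_le
    have h3 := ((h.bump hl hxy hb).sublist ha).length_le
    simp at h1 h2 h3 ⊢
    omega

/-- An invariant strong enough for induction: an entry that can still be bumped exceeds all inserted
letters, so the second alternative makes the bumped entries weakly increasing. -/
theorem le_or_le (h : Inserts a b r s) (ha : a.Pairwise (· ≤ ·)) :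
    ∀ e ∈ s, ∀ z ∈ r, (∃ u ∈ b, z ≤ u) ∨ e ≤ z := by
  induction h with
  | nil => simp
  | @append b r s x _ _ _ ih =>
    intro e he z hz
    rcases List.mem_append.1 hz with hz | hz
    · rcases ih e he z hz with ⟨u, hu, hzu⟩ | h
      · exact Or.inl ⟨u, by simp [hu], hzu⟩
      · exact Or.inr h
    · exact Or.inl ⟨x, by simp, by simpa using (List.mem_singleton.1 hz).le⟩
  | @bump b l₁ l₂ s x y h hl hxy hb ih =>
    intro e he z hz
    rcases List.mem_append.1 hz with hz | hz
    · exact Or.inl ⟨x, by simp, hl z hz⟩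
    rcases List.mem_cons.1 hz with rfl | hz
    · exact Or.inl ⟨z, by simp, le_rfl⟩
    rcases List.mem_append.1 he with he | he
    · rcases ih e he z (by simp [hz]) with ⟨u, hu, hzu⟩ | h
      · exact Or.inl ⟨u, by simp [hu], hzu⟩
      · exact Or.inr h
    · have := h.pairwise_fst ha
      simp only [List.pairwise_append, List.pairwise_cons] at this
      rw [List.mem_singleton.1 he]
      exact Or.inr (this.2.1.1 z hz)

theorem le_of_lt {x y : ℕ} (h : Inserts a b r s) (ha : a.Pairwise (· ≤ ·))
    (hb : ∀ z ∈ b, z ≤ x) (hy : y ∈ r) (hxy : x < y) : ∀ e ∈ s, e ≤ y := by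
  intro e he
  rcases h.le_or_le ha e he y hy with ⟨u, hu, hyu⟩ | h
  · exact absurd (hyu.trans (hb u hu)) (not_le.2 hxy)
  · exact h

theorem pairwise_snd (h : Inserts a b r s) (ha : a.Pairwise (· ≤ ·)) : s.Pairwise (· ≤ ·) := by
  induction h with
  | nil => simp
  | append _ _ _ ih => exact ih
  | @bump b l₁ l₂ s x y h hl hxy hb ih =>
    simpa [List.pairwise_append, ih] using h.le_of_lt ha hb (y := y) (by simp) hxy

theorem exists_lt (h : Inserts a b r s) (hle : r.length ≤ a.length) :
    ∀ u ∈ b, ∃ y ∈ s, u < y := by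
  induction h with
  | nil => simp
  | append h _ _ _ =>
    have := h.length_le
    simp at hle
    omega
  | @bump b l₁ l₂ s x y h hl hxy hb ih =>
    intro u hu
    refine ⟨y, by simp, lt_of_le_of_lt ?_ hxy⟩
    rcases List.mem_append.1 hu with hu | hu
    · exact hb u hu
    · exact (List.mem_singleton.1 hu).le

theorem column_strict (h : Inserts a b r s) (ha : a.Pairwise (· ≤ ·)) :
    ∀ i < s.length, r.getD i 0 < s.getD i 0 := by
  induction h with
  | nil => simp
  | @append b r s x h _ _ ih =>
    intro i hi
    have h1 := h.length_le
    have h2 := h.length_snd_le_row ha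
    rw [List.getD_append _ _ _ _ (by omega)]
    exact ih i hi
  | @bump b l₁ l₂ s x y h hl hxy hb ih =>
    intro i hi
    have h1 := h.length_snd_le
    -- The earlier letters all lie left of the bumped cell, so |s| ≤ |b| ≤ |l₁|: the old columns are
    -- untouched, and the entry above the new cell is at most x < y.
    have h2 := (sublist_left (h.pairwise_fst ha) hl hxy hb (h.sublist ha)).length_le
    simp only [List.length_append, List.length_singleton] at hi
    rcases Nat.lt_or_ge i s.length with hi' | hi'
    · have := ih i hi'
      rw [List.getD_append _ _ _ _ (by omega)] at this ⊢
      rwa [List.getD_append _ _ _ _ hi']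
    · obtain rfl : i = s.length := by omega
      rw [List.getD_append_right s _ _ _ le_rfl]
      rcases Nat.lt_or_ge s.length l₁.length with h3 | h3
      · rw [List.getD_append _ _ _ _ h3, List.getD_eq_getElem _ _ h3]
        simpa using (hl _ (List.getElem_mem h3)).trans_lt hxy
      · rw [List.getD_append_right _ _ _ _ h3]
        simpa [show s.length - l₁.length = 0 by omega] using hxy

/-! ### Reversing the insertion -/

theorem eq_of_append_cons_eq {l₁ l₂ m₁ m₂ : List ℕ} {x x' y : ℕ}
    (h : l₁ ++ x :: l₂ = m₁ ++ x' :: m₂) (hl : ∀ z ∈ l₁, z < y) (hm : ∀ z ∈ m₁, z < y)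
    (hx : x < y) (hx' : x' < y) (hl' : ∀ z ∈ l₂, y ≤ z) (hm' : ∀ z ∈ m₂, y ≤ z) :
    l₁ = m₁ ∧ x = x' ∧ l₂ = m₂ := by
  have key : ∀ {l₁ l₂ : List ℕ} {x : ℕ}, (∀ z ∈ l₁, z < y) → x < y → (∀ z ∈ l₂, y ≤ z) →
      (l₁ ++ x :: l₂).filter (· < y) = l₁ ++ [x] := by
    intro l₁ l₂ x h1 h2 h3
    rw [List.filter_append, List.filter_eq_self.2 (by simpa using h1),
      List.filter_cons_of_pos (by simpa using h2), List.filter_eq_nil_iff.2 (by simpa using h3)]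
  have h1 := congrArg (List.filter (· < y)) h
  rw [key hl hx hl', key hm hx' hm'] at h1
  obtain ⟨rfl, h2⟩ := List.append_inj' h1 rfl
  obtain rfl : x = x' := by simpa using h2
  simpa using h

/-- The inserted letters and the initial row are determined by the result and the length of the
initial row. -/
theorem injective {a' b' : List ℕ} (h : Inserts a b r s) (h' : Inserts a' b' r s)
    (ha : a.Pairwise (· ≤ ·)) (ha' : a'.Pairwise (· ≤ ·)) (hlen : a.length = a'.length) :
    a = a' ∧ b = b' := by
  induction h generalizing b' with
  | nil =>
    have := h'.length_add
    obtain rfl : b' = [] := List.length_eq_zero_iff.1 (by simp at this; omega)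
    exact ⟨List.Perm.eq_of_pairwise' ha ha' (by simpa using h'.perm), rfl⟩
  | @append b r s x h hr hb ih =>
    -- Comparing the length of the first row with that of the initial row tells whether the last
    -- step appended or bumped, so the mixed cases are impossible.
    generalize hR : r ++ [x] = R at h'
    cases h' with
    | nil =>
      have := h.length_le
      have := congrArg List.length hR
      simp at this; omega
    | @append b' r' _ x' h₁ hr' hb' =>
      obtain ⟨rfl, h2⟩ := List.append_inj' hR rfl
      obtain rfl : x = x' := by simpa using h2
      obtain ⟨rfl, rfl⟩ := ih h₁
      exact ⟨rfl, rfl⟩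
    | @bump b' l₁ l₂ s' x' y h₁ hl' hxy' hb' =>
      have h2 := h₁.length_eq_of_lt hb' (y := y) (by simp) hxy'
      have := h.length_le
      have := congrArg List.length hR
      simp at this h2; omega
  | @bump b l₁ l₂ s x y h hl hxy hb ih =>
    generalize hR : l₁ ++ x :: l₂ = R at h'
    generalize hS : s ++ [y] = S at h'
    have h1 := h.length_eq_of_lt hb (y := y) (by simp) hxy
    cases h' with
    | nil => simp at hS
    | @append b' r' _ x' h₁ hr' hb' =>
      have := h₁.length_le
      have := congrArg List.length hR
      simp at this h1; omega
    | @bump b' m₁ m₂ s' x' y' h₁ hl' hxy' hb' =>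
      obtain ⟨rfl, h2⟩ := List.append_inj' hS rfl
      obtain rfl : y = y' := by simpa using h2
      have h3 := h.pairwise_fst ha
      have h4 := h₁.pairwise_fst ha'
      simp only [List.pairwise_append, List.pairwise_cons] at h3 h4
      obtain ⟨rfl, rfl, rfl⟩ := eq_of_append_cons_eq hR (fun z hz => (hl z hz).trans_lt hxy)
        (fun z hz => (hl' z hz).trans_lt hxy') hxy hxy' h3.2.1.1 h4.2.1.1
      obtain ⟨rfl, rfl⟩ := ih h₁
      exact ⟨rfl, rfl⟩

theorem exists_split {y : ℕ} (hr : r.Pairwise (· ≤ ·)) (hy : ∃ z ∈ r, z < y) :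
    ∃ l₁ x l₂, r = l₁ ++ x :: l₂ ∧ x < y ∧ ∀ z ∈ l₂, y ≤ z := by
  induction r using List.reverseRecOn with
  | nil => simp at hy
  | append_singleton r w ih =>
    rcases lt_or_ge w y with hw | hw
    · exact ⟨r, w, [], by simp, hw, by simp⟩
    · obtain ⟨l₁, x, l₂, rfl, hx, hl⟩ := ih (List.pairwise_append.1 hr).1 (by
        obtain ⟨z, hz, hzy⟩ := hy
        rcases List.mem_append.1 hz with hz | hz
        · exact ⟨z, hz, hzy⟩
        · rw [List.mem_singleton.1 hz] at hzy; omega)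
      refine ⟨l₁, x, l₂ ++ [w], by simp, hx, ?_⟩
      intro z hz
      rcases List.mem_append.1 hz with hz | hz
      · exact hl z hz
      · rwa [List.mem_singleton.1 hz]

/-- Reverse bumping: the last entry y of the second row goes back in place of the rightmost smaller
entry x of the first row, and x is the last inserted letter. -/
theorem exists_of_length_eq (hr : r.Pairwise (· ≤ ·)) (hs : s.Pairwise (· ≤ ·))
    (hle : s.length ≤ r.length) (hcol : ∀ i < s.length, r.getD i 0 < s.getD i 0) :
    ∃ a b, a.Pairwise (· ≤ ·) ∧ a.length = r.length ∧ Inserts a b r s := by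
  induction s using List.reverseRecOn generalizing r with
  | nil => exact ⟨r, [], hr, rfl, .nil⟩
  | append_singleton s y ih =>
    simp only [List.length_append, List.length_singleton] at hle hcol
    have hd := hcol s.length (by omega)
    rw [List.getD_append_right s _ _ _ le_rfl, List.getD_eq_getElem _ _ (by omega)] at hd
    simp only [Nat.sub_self, List.getD_cons_zero] at hd
    obtain ⟨l₁, x, l₂, rfl, hx, hl⟩ := exists_split hr ⟨_, List.getElem_mem _, hd⟩
    have hd' : s.length ≤ l₁.length := by
      by_contra hlt
      have hmem := List.getElem_mem (l := l₂) (n := s.length - l₁.length - 1)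
        (by simp at hle; omega)
      rw [List.getElem_append_right (by omega), List.getElem_cons, dif_neg (by omega)] at hd
      exact absurd (hl _ hmem) (not_le.2 hd)
    rw [List.pairwise_append, List.pairwise_cons] at hr
    rw [List.pairwise_append] at hs
    have hlx : ∀ z ∈ l₁, z ≤ x := fun z hz => hr.2.2 z hz x (by simp)
    obtain ⟨a, b, ha, hlen, h⟩ := ih (r := l₁ ++ y :: l₂) (by
        rw [List.pairwise_append, List.pairwise_cons]
        refine ⟨hr.1, ⟨hl, hr.2.1.2⟩, ?_⟩
        intro u hu v hv
        rcases List.mem_cons.1 hv with rfl | hv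
        · exact ((hlx u hu).trans_lt hx).le
        · exact hr.2.2 u hu v (by simp [hv])) hs.1 (by simp at hle ⊢; omega) (by
        intro i hi
        have := hcol i (by omega)
        rw [List.getD_append _ _ _ _ (by omega), List.getD_append _ _ _ _ hi] at this
        rwa [List.getD_append _ _ _ _ (by omega)])
    refine ⟨a, b ++ [x], ha, by simpa using hlen, h.bump hlx hx fun u hu => ?_⟩
    -- An earlier letter u is below some bumped e ≤ y, so it lies left of y in the row and is at
    -- most x.
    obtain ⟨e, he, hue⟩ := h.exists_lt hlen.ge u hu
    have huy : u < y := hue.trans_le (hs.2.2 e he y (by simp))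
    rcases List.mem_append.1 ((h.sublist ha).subset hu) with hu' | hu'
    · exact hlx u hu'
    · rcases List.mem_cons.1 hu' with rfl | hu'
      · exact absurd huy (lt_irrefl _)
      · exact absurd (hl u hu') (not_le.2 huy)

/-- Every column strict tableau with at most two rows results from inserting a weakly increasing
list into a row of prescribed length. -/
theorem exists_of_column_strict {p : ℕ} (hr : r.Pairwise (· ≤ ·)) (hs : s.Pairwise (· ≤ ·))
    (hsp : s.length ≤ p) (hpr : p ≤ r.length)
    (hcol : ∀ i < s.length, r.getD i 0 < s.getD i 0) :
    ∃ a b, a.Pairwise (· ≤ ·) ∧ a.length = p ∧ Inserts a b r s := by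
  induction r using List.reverseRecOn with
  | nil =>
    obtain ⟨a, b, ha, hlen, h⟩ :=
      exists_of_length_eq (r := []) (s := s) hr hs (hsp.trans hpr) hcol
    exact ⟨a, b, ha, hlen.trans (Nat.le_zero.1 hpr).symm, h⟩
  | append_singleton r x ih =>
    rcases hpr.eq_or_lt with rfl | hlt
    · exact exists_of_length_eq hr hs hsp hcol
    · rw [List.pairwise_append] at hr
      simp only [List.length_append, List.length_singleton] at hlt
      obtain ⟨a, b, ha, hlen, h⟩ := ih hr.1 (by omega) (fun i hi => by
        have := hcol i hi
        rwa [List.getD_append _ _ _ _ (by omega)] at this)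
      have hx : ∀ z ∈ r, z ≤ x := fun z hz => hr.2.2 z hz x (by simp)
      exact ⟨a, b ++ [x], ha, hlen, h.append hx fun z hz => hx z ((h.sublist ha).subset hz)⟩

theorem exists_of_pairwise (a : List ℕ) (hb : b.Pairwise (· ≤ ·)) :
    ∃ r s, Inserts a b r s := by
  induction b using List.reverseRecOn with
  | nil => exact ⟨a, [], .nil⟩
  | append_singleton b x ih =>
    rw [List.pairwise_append] at hb
    obtain ⟨r, s, h⟩ := ih hb.1
    have hbx : ∀ z ∈ b, z ≤ x := fun z hz => hb.2.2 z hz x (by simp)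
    by_cases hr : ∀ z ∈ r, z ≤ x
    · exact ⟨_, _, h.append hr hbx⟩
    · have hsplit : ∀ r : List ℕ, (¬ ∀ z ∈ r, z ≤ x) →
          ∃ l₁ y l₂, r = l₁ ++ y :: l₂ ∧ (∀ z ∈ l₁, z ≤ x) ∧ x < y := by
        intro r
        induction r with
        | nil => simp
        | cons w r ih =>
          intro hr
          rcases lt_or_ge x w with hw | hw
          · exact ⟨[], w, r, by simp, by simp, hw⟩
          · obtain ⟨l₁, y, l₂, rfl, h1, h2⟩ := ih (by simpa [hw] using hr)
            exact ⟨w :: l₁, y, l₂, by simp, by simpa [hw] using h1, h2⟩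
      obtain ⟨l₁, y, l₂, rfl, h1, h2⟩ := hsplit r hr
      exact ⟨_, _, h.bump h1 h2 hbx⟩

end Inserts

/-! ### The algorithm on tableaux with at most two rows -/

theorem rowInsert_of_le {x : ℕ} {r : List ℕ} (h : ∀ z ∈ r, z ≤ x) :
    rowInsert x r = (r ++ [x], none) := by
  induction r with
  | nil => rfl
  | cons w r ih =>
    simp only [List.mem_cons, forall_eq_or_imp] at h
    rw [rowInsert, if_neg (not_lt.2 h.1), ih h.2]
    rfl

theorem rowInsert_of_lt {x y : ℕ} {l₁ l₂ : List ℕ} (h : ∀ z ∈ l₁, z ≤ x) (hxy : x < y) :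
    rowInsert x (l₁ ++ y :: l₂) = (l₁ ++ x :: l₂, some y) := by
  induction l₁ with
  | nil => simp [rowInsert, hxy]
  | cons w r ih =>
    simp only [List.mem_cons, forall_eq_or_imp] at h
    rw [List.cons_append, rowInsert, if_neg (not_lt.2 h.1), ih h.2]
    rfl

/-- The list of nonempty rows of a tableau with first row `r` and second row `s`. -/
def twoRows (r s : List ℕ) : List (List ℕ) :=
  [r, s].filter (· ≠ [])

@[simp] theorem twoRows_nil_nil : twoRows [] [] = [] := rfl

@[simp] theorem twoRows_cons_nil (x : ℕ) (r : List ℕ) : twoRows (x :: r) [] = [x :: r] := rfl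

@[simp] theorem twoRows_cons_cons (x y : ℕ) (r s : List ℕ) :
    twoRows (x :: r) (y :: s) = [x :: r, y :: s] := rfl

theorem twoRows_of_ne_nil {r : List ℕ} (hr : r ≠ []) (s : List ℕ) :
    twoRows r s = r :: twoRows s [] := by
  cases r <;> cases s <;> first | rfl | exact absurd rfl hr

/-- The length bounds exclude an empty first row above a nonempty second one, which `twoRows` would
confuse with a single row. -/
theorem twoRows_injective {r s r' s' : List ℕ} (h : s.length ≤ r.length)
    (h' : s'.length ≤ r'.length) (heq : twoRows r s = twoRows r' s') : r = r' ∧ s = s' := by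
  cases r <;> cases s <;> cases r' <;> cases s' <;> simp_all

theorem tableauInsert_of_le {x : ℕ} {r s : List ℕ} (h : ∀ z ∈ r, z ≤ x)
    (hs : s.length ≤ r.length) :
    tableauInsert x (twoRows r s) = (twoRows (r ++ [x]) s, 0) := by
  cases r with
  | nil =>
    obtain rfl : s = [] := List.length_eq_zero_iff.1 (Nat.le_zero.1 hs)
    rfl
  | cons w r =>
    rw [twoRows_of_ne_nil (List.cons_ne_nil w r), tableauInsert, rowInsert_of_le h,
      twoRows_of_ne_nil (by simp : w :: r ++ [x] ≠ [])]

theorem tableauInsert_of_lt {x y : ℕ} {l₁ l₂ s : List ℕ} (h : ∀ z ∈ l₁, z ≤ x) (hxy : x < y)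
    (hs : ∀ z ∈ s, z ≤ y) :
    tableauInsert x (twoRows (l₁ ++ y :: l₂) s) = (twoRows (l₁ ++ x :: l₂) (s ++ [y]), 1) := by
  rw [twoRows_of_ne_nil (by simp : l₁ ++ y :: l₂ ≠ []), tableauInsert, rowInsert_of_lt h hxy,
    twoRows_of_ne_nil (by simp : l₁ ++ x :: l₂ ≠ [])]
  simp only [tableauInsert_of_le (s := []) hs (Nat.zero_le _)]

theorem addCell_zero_twoRows {y : ℕ} {r s : List ℕ} (hs : s.length ≤ r.length) :
    addCell y 0 (twoRows r s) = twoRows (r ++ [y]) s := by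
  cases r with
  | nil =>
    obtain rfl : s = [] := List.length_eq_zero_iff.1 (Nat.le_zero.1 hs)
    rfl
  | cons w r =>
    rw [twoRows_of_ne_nil (List.cons_ne_nil w r), addCell,
      twoRows_of_ne_nil (by simp : w :: r ++ [y] ≠ [])]

theorem addCell_one_twoRows {y : ℕ} {r s : List ℕ} (hr : r ≠ []) :
    addCell y 1 (twoRows r s) = twoRows r (s ++ [y]) := by
  rw [twoRows_of_ne_nil hr, addCell, addCell_zero_twoRows (Nat.zero_le _),
    twoRows_of_ne_nil hr]

/-- The two-line array whose top row consists of letters `1` above `a` and letters `4` above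
`b`. -/
def biword (a b : List ℕ) : List (ℕ × ℕ) :=
  a.map (Prod.mk 1) ++ b.map (Prod.mk 4)

theorem foldl_step_row {a : List ℕ} (ha : a.Pairwise (· ≤ ·)) :
    (a.map (Prod.mk 1)).foldl step ([], []) =
      (twoRows a [], twoRows (List.replicate a.length 1) []) := by
  induction a using List.reverseRecOn with
  | nil => rfl
  | append_singleton a x ih =>
    rw [List.pairwise_append] at ha
    rw [List.map_append, List.foldl_append, ih ha.1]
    simp only [List.map_cons, List.map_nil, List.foldl_cons, List.foldl_nil, step]
    rw [tableauInsert_of_le (fun z hz => ha.2.2 z hz x (by simp)) (Nat.zero_le _),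
      addCell_zero_twoRows (Nat.zero_le _), List.length_append, List.length_singleton,
      List.replicate_succ']

theorem Inserts.foldl_step {a b r s : List ℕ} (h : Inserts a b r s) (ha : a.Pairwise (· ≤ ·)) :
    (biword a b).foldl step ([], []) =
      (twoRows r s, twoRows
        (List.replicate a.length 1 ++ List.replicate (r.length - a.length) 4)
        (List.replicate s.length 4)) := by
  induction h with
  | nil => simpa [biword] using foldl_step_row ha
  | @append b r s x h hr _ ih =>
    have h1 := h.length_le
    have h2 := h.length_snd_le_row ha
    rw [biword, List.map_append, ← List.append_assoc, ← biword, List.foldl_append, ih]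
    simp only [List.map_cons, List.map_nil, List.foldl_cons, List.foldl_nil, step]
    rw [tableauInsert_of_le hr (by omega), addCell_zero_twoRows (by simp; omega),
      List.length_append, List.length_singleton, Nat.sub_add_comm h1, List.replicate_succ',
      List.append_assoc]
  | @bump b l₁ l₂ s x y h hl hxy hb ih =>
    have h1 := h.length_le
    have h2 := (h.bump hl hxy hb).length_snd_le_row ha
    rw [biword, List.map_append, ← List.append_assoc, ← biword, List.foldl_append, ih]
    simp only [List.map_cons, List.map_nil, List.foldl_cons, List.foldl_nil, step]
    rw [tableauInsert_of_lt hl hxy (h.le_of_lt ha hb (by simp) hxy), addCell_one_twoRows,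
      List.length_append (as := s), List.length_singleton, List.replicate_succ']
    · simp
    · intro h3
      have := congrArg List.length h3
      simp at this h2
      simp [this] at h2

/-! ### Multisets of biletters with tops 1 and 4 -/

/-- The multiset of biletters with bottoms `a` below `1` and bottoms `b` below `4`. -/
def biletters14 (a b : List ℕ) : Multiset (ℕ ×ₗ ℕ) :=
  ((biword a b).map toLex : List (ℕ ×ₗ ℕ))

theorem sort_biletters14 {a b : List ℕ} (ha : a.Pairwise (· ≤ ·)) (hb : b.Pairwise (· ≤ ·)) :
    (biletters14 a b).sort (· ≤ ·) = (biword a b).map toLex := by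
  refine List.Perm.eq_of_pairwise' (Multiset.pairwise_sort _ _) ?_
    (Multiset.coe_eq_coe.1 (Multiset.sort_eq _ _))
  simp only [biword, List.map_append, List.pairwise_append, List.map_map, List.pairwise_map]
  refine ⟨ha.imp ?_, hb.imp ?_, ?_⟩
  · intro x y h
    simpa [Prod.Lex.toLex_le_toLex] using h
  · intro x y h
    simpa [Prod.Lex.toLex_le_toLex] using h
  · simp [Prod.Lex.toLex_le_toLex]

theorem Inserts.rsk_eq {a b r s : List ℕ} (h : Inserts a b r s) (ha : a.Pairwise (· ≤ ·)) :
    rsk (biletters14 a b) = (twoRows r s, twoRows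
        (List.replicate a.length 1 ++ List.replicate (r.length - a.length) 4)
        (List.replicate s.length 4)) := by
  rw [rsk, sort_biletters14 ha h.pairwise_letters, List.map_map]
  simpa [Function.comp_def] using h.foldl_step ha

theorem sum_biletters14 (a b : List ℕ) :
    ((biletters14 a b).map fun c => (ofLex c).2 + (ofLex c).1).sum =
      a.sum + b.sum + (a.length + 4 * b.length) := by
  have key : ∀ (l : List ℕ) (k : ℕ), (l.map fun x => x + k).sum = l.sum + l.length * k := by
    intro l k
    induction l with
    | nil => simp
    | cons x l ih => simp [ih]; ring
  simp only [biletters14, biword, Multiset.map_coe, Multiset.sum_coe, List.map_append,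
    List.map_map, List.sum_append, Function.comp_def, ofLex_toLex, key]
  ring

theorem exists_biletters14 (s : Multiset (ℕ ×ₗ ℕ))
    (hs : ∀ c ∈ s, (ofLex c).1 = 1 ∨ (ofLex c).1 = 4) :
    ∃ a b : List ℕ, a.Pairwise (· ≤ ·) ∧ b.Pairwise (· ≤ ·) ∧ s = biletters14 a b := by
  let bottoms (k : ℕ) : Multiset ℕ :=
    (s.filter fun c => (ofLex c).1 = k).map fun c => (ofLex c).2
  have key : ∀ k, (((bottoms k).sort (· ≤ ·)).map (Prod.mk k) : Multiset (ℕ × ℕ)).map toLex =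
      s.filter fun c => (ofLex c).1 = k := by
    intro k
    rw [← Multiset.map_coe, Multiset.sort_eq, Multiset.map_map, Multiset.map_map]
    conv_rhs => rw [← Multiset.map_id (s.filter _)]
    refine Multiset.map_congr rfl fun c hc => ?_
    rw [← (Multiset.mem_filter.1 hc).2]
    rfl
  refine ⟨(bottoms 1).sort (· ≤ ·), (bottoms 4).sort (· ≤ ·), Multiset.pairwise_sort _ _,
    Multiset.pairwise_sort _ _, ?_⟩
  rw [biletters14, biword, ← Multiset.map_coe, ← Multiset.coe_add, Multiset.map_add, key, key]
  conv_lhs => rw [← Multiset.filter_add_not (fun c => (ofLex c).1 = 1) s]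
  congr 1
  refine Multiset.filter_congr fun c hc => ?_
  rcases hs c hc with h | h <;> simp [h]

/-! ### Semistandard tableaux as pairs of rows -/

/-- The row of a tableau with index `i`, read from left to right. -/
def rowList {μ : YoungDiagram} (T : SemistandardYoungTableau μ) (i : ℕ) : List ℕ :=
  (List.range (μ.rowLen i)).map fun j => T i j

section Rows

variable {μ : YoungDiagram} (T : SemistandardYoungTableau μ)

@[simp] theorem length_rowList (i : ℕ) : (rowList T i).length = μ.rowLen i := by
  simp [rowList]

theorem getD_rowList (i j : ℕ) : (rowList T i).getD j 0 = T i j := by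
  by_cases h : j < μ.rowLen i
  · rw [List.getD_eq_getElem _ _ (by simpa using h)]
    simp [rowList]
  · rw [List.getD_eq_default _ _ (by simpa using h)]
    exact (T.zeros fun h' => h (YoungDiagram.mem_iff_lt_rowLen.1 h')).symm

theorem mem_rowList {i z : ℕ} : z ∈ rowList T i ↔ ∃ j, (i, j) ∈ μ ∧ T i j = z := by
  simp [rowList, YoungDiagram.mem_iff_lt_rowLen]

theorem pairwise_rowList (i : ℕ) : (rowList T i).Pairwise (· ≤ ·) := by
  rw [rowList, List.pairwise_map, List.pairwise_iff_getElem]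
  intro j k hj hk hjk
  simp only [List.getElem_range]
  exact T.row_weak hjk (YoungDiagram.mem_iff_lt_rowLen.2 (by simpa using hk))

theorem getD_rowList_lt {i : ℕ} (hi : i < (rowList T 1).length) :
    (rowList T 0).getD i 0 < (rowList T 1).getD i 0 := by
  rw [getD_rowList, getD_rowList]
  exact T.col_strict Nat.zero_lt_one (YoungDiagram.mem_iff_lt_rowLen.2 (by simpa using hi))

theorem length_rowList_le : (rowList T 1).length ≤ (rowList T 0).length := by
  simpa using μ.rowLen_anti 0 1 zero_le_one

theorem rowLen_eq_zero_iff (μ : YoungDiagram) (i : ℕ) : μ.rowLen i = 0 ↔ μ.colLen 0 ≤ i := by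
  rw [← not_lt, ← YoungDiagram.mem_iff_lt_colLen, YoungDiagram.mem_iff_lt_rowLen]
  omega

theorem rowList_eq_nil_iff (i : ℕ) : rowList T i = [] ↔ μ.colLen 0 ≤ i := by
  rw [← List.length_eq_zero_iff, length_rowList, rowLen_eq_zero_iff]

theorem rows_eq_twoRows (hμ : μ.colLen 0 ≤ 2) :
    rows T = twoRows (rowList T 0) (rowList T 1) := by
  have h0 := rowList_eq_nil_iff T 0
  have h1 := rowList_eq_nil_iff T 1
  have hrows : rows T = (List.range (μ.colLen 0)).map (rowList T) := rfl
  rw [hrows, twoRows]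
  generalize μ.colLen 0 = k at *
  interval_cases k <;> simp_all [List.range_succ]

theorem sum_cells (hμ : μ.colLen 0 ≤ 2) :
    ∑ c ∈ μ.cells, T c.1 c.2 = (rowList T 0).sum + (rowList T 1).sum := by
  have hrow : ∀ i, ∑ c ∈ μ.row i, T c.1 c.2 = (rowList T i).sum := by
    intro i
    rw [YoungDiagram.row_eq_prod, Finset.sum_product, Finset.sum_singleton, rowList,
      Finset.sum_eq_multiset_sum]
    rfl
  rw [← hrow, ← hrow, ← Finset.sum_filter_add_sum_filter_not μ.cells (fun c => c.1 = 0)]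
  congr 1
  refine Finset.sum_congr (Finset.filter_congr fun c hc => ?_) fun _ _ => rfl
  obtain ⟨i, j⟩ := c
  have h1 := YoungDiagram.mem_iff_lt_colLen.1 ((YoungDiagram.mem_cells _).1 hc)
  have h2 := μ.colLen_anti 0 j (Nat.zero_le _)
  simp only
  omega

theorem forall_cells (hμ : μ.colLen 0 ≤ 2) (p : ℕ → Prop) :
    (∀ c ∈ μ.cells, p (T c.1 c.2)) ↔ (∀ z ∈ rowList T 0, p z) ∧ ∀ z ∈ rowList T 1, p z := by
  constructor
  · intro h
    constructor <;>
    · intro z hz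
      obtain ⟨j, hj, rfl⟩ := (mem_rowList T).1 hz
      exact h _ ((YoungDiagram.mem_cells _).2 hj)
  · rintro ⟨h0, h1⟩ ⟨i, j⟩ hc
    rw [YoungDiagram.mem_cells] at hc
    have h2 := YoungDiagram.mem_iff_lt_colLen.1 hc
    have h3 := μ.colLen_anti 0 j (Nat.zero_le _)
    have hi : i < 2 := by omega
    interval_cases i
    · exact h0 _ ((mem_rowList T).2 ⟨j, hc, rfl⟩)
    · exact h1 _ ((mem_rowList T).2 ⟨j, hc, rfl⟩)

end Rows

theorem diagram_eq {μ ν : YoungDiagram} (hμ : μ.colLen 0 ≤ 2) (hν : ν.colLen 0 ≤ 2)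
    (h0 : μ.rowLen 0 = ν.rowLen 0) (h1 : μ.rowLen 1 = ν.rowLen 1) : μ = ν := by
  have h : ∀ i, μ.rowLen i = ν.rowLen i := by
    intro i
    match i with
    | 0 => exact h0
    | 1 => exact h1
    | i + 2 =>
      rw [(rowLen_eq_zero_iff μ _).2 (by omega), (rowLen_eq_zero_iff ν _).2 (by omega)]
  ext ⟨i, j⟩
  simp [YoungDiagram.mem_cells, YoungDiagram.mem_iff_lt_rowLen, h]

theorem tableau_eq {μ : YoungDiagram} {T T' : SemistandardYoungTableau μ}
    (hμ : μ.colLen 0 ≤ 2) (h : rows T = rows T') : T = T' := by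
  rw [rows_eq_twoRows T hμ, rows_eq_twoRows T' hμ] at h
  obtain ⟨h0, h1⟩ := twoRows_injective (length_rowList_le T) (length_rowList_le T') h
  ext i j
  match i with
  | 0 => rw [← getD_rowList, h0, getD_rowList]
  | 1 => rw [← getD_rowList, h1, getD_rowList]
  | i + 2 =>
    have h2 : (i + 2, j) ∉ μ := by
      rw [YoungDiagram.mem_iff_lt_rowLen, (rowLen_eq_zero_iff μ _).2 (by omega)]
      simp
    rw [T.zeros h2, T'.zeros h2]

theorem TableauPair.eq_of_rows_eq {n : ℕ} {T T' : TableauPair n} (hP : rows T.P = rows T'.P)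
    (hQ : rows T.Q = rows T'.Q) : T = T' := by
  obtain ⟨μ, P, Q, h2, h3, h4, h5⟩ := T
  obtain ⟨μ', P', Q', h2', h3', h4', h5'⟩ := T'
  simp only at hP hQ
  obtain rfl : μ = μ' := by
    rw [rows_eq_twoRows P h2, rows_eq_twoRows P' h2'] at hP
    obtain ⟨e0, e1⟩ := twoRows_injective (length_rowList_le P) (length_rowList_le P') hP
    exact diagram_eq h2 h2' (by simpa using congrArg List.length e0)
      (by simpa using congrArg List.length e1)
  obtain rfl := tableau_eq h2 hP
  obtain rfl := tableau_eq h2 hQ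
  rfl

/-- The Young diagram with rows of lengths `k` and `l`. -/
def twoRowDiagram (k l : ℕ) (h : l ≤ k) : YoungDiagram :=
  YoungDiagram.ofRowLens [k, l] (List.Pairwise.sortedGE (by simpa using h))

theorem mem_twoRowDiagram {k l i j : ℕ} (h : l ≤ k) :
    (i, j) ∈ twoRowDiagram k l h ↔ (i = 0 ∧ j < k) ∨ (i = 1 ∧ j < l) := by
  rw [twoRowDiagram, YoungDiagram.mem_ofRowLens]
  match i with
  | 0 => simp
  | 1 => simp
  | i + 2 => simp

theorem colLen_twoRowDiagram_le {k l : ℕ} (h : l ≤ k) :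
    (twoRowDiagram k l h).colLen 0 ≤ 2 := by
  by_contra hlt
  have := YoungDiagram.mem_iff_lt_colLen.2 (not_le.1 hlt)
  simp [mem_twoRowDiagram] at this

theorem exists_tableau {k l : ℕ} (h : l ≤ k) {r s : List ℕ} (hr : r.Pairwise (· ≤ ·))
    (hs : s.Pairwise (· ≤ ·)) (hk : r.length = k) (hl : s.length = l)
    (hcol : ∀ i < s.length, r.getD i 0 < s.getD i 0) :
    ∃ T : SemistandardYoungTableau (twoRowDiagram k l h), rowList T 0 = r ∧ rowList T 1 = s := by
  subst hk hl
  have weak : ∀ {t : List ℕ}, t.Pairwise (· ≤ ·) → ∀ {i j : ℕ}, i < j → j < t.length →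
      t.getD i 0 ≤ t.getD j 0 := by
    intro t ht i j hij hj
    rw [List.getD_eq_getElem _ _ hj, List.getD_eq_getElem _ _ (hij.trans hj)]
    exact List.pairwise_iff_getElem.1 ht i j _ _ hij
  let T : SemistandardYoungTableau (twoRowDiagram r.length s.length h) :=
    { entry := fun i j => match i with
        | 0 => r.getD j 0
        | 1 => s.getD j 0
        | _ + 2 => 0
      row_weak' := by
        intro i j₁ j₂ hj hc
        rcases (mem_twoRowDiagram h).1 hc with ⟨rfl, hj₂⟩ | ⟨rfl, hj₂⟩
        · exact weak hr hj hj₂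
        · exact weak hs hj hj₂
      col_strict' := by
        intro i₁ i₂ j hi hc
        rcases (mem_twoRowDiagram h).1 hc with ⟨rfl, hj⟩ | ⟨rfl, hj⟩
        · exact absurd hi (Nat.not_lt_zero _)
        · obtain rfl : i₁ = 0 := by omega
          exact hcol j hj
      zeros' := by
        intro i j hc
        rw [mem_twoRowDiagram] at hc
        match i with
        | 0 => exact List.getD_eq_default _ _ (by simpa using hc)
        | 1 => exact List.getD_eq_default _ _ (by simpa using hc)
        | _ + 2 => rfl }
  have hlen : ∀ (i : ℕ) (t : List ℕ), (∀ j, (i, j) ∈ twoRowDiagram r.length s.length h ↔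
      j < t.length) → (∀ j, T i j = t.getD j 0) → rowList T i = t := by
    intro i t h1 h2
    have h3 : (rowList T i).length = t.length := by
      rw [length_rowList]
      refine eq_of_forall_lt_iff fun j => ?_
      rw [← YoungDiagram.mem_iff_lt_rowLen, h1]
    refine List.ext_getElem h3 fun j h4 h5 => ?_
    rw [← List.getD_eq_getElem _ 0 h4, ← List.getD_eq_getElem _ 0 h5, getD_rowList, h2]
  exact ⟨T, hlen 0 r (fun j => by simp [mem_twoRowDiagram]) fun _ => rfl,
    hlen 1 s (fun j => by simp [mem_twoRowDiagram]) fun _ => rfl⟩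

/-! ### Partitions as multisets of biletters -/

theorem mem_biletters14 {a b : List ℕ} {c : ℕ ×ₗ ℕ} :
    c ∈ biletters14 a b ↔ (∃ x ∈ a, c = toLex (1, x)) ∨ ∃ x ∈ b, c = toLex (4, x) := by
  simp [biletters14, biword, eq_comm]

theorem map_biletters {n : ℕ} (p : n.Partition) :
    (biletters p).map (fun c => (ofLex c).2 + (ofLex c).1) = p.parts := by
  simp [biletters, Multiset.map_map, Function.comp_def, Nat.div_add_mod]

theorem biletters_injective {n : ℕ} : Function.Injective (biletters (n := n)) := fun p p' h =>
  Nat.Partition.ext (by rw [← map_biletters p, h, map_biletters])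

theorem sum_of_biletters_eq {n : ℕ} {p : n.Partition} {a b : List ℕ}
    (h : biletters p = biletters14 a b) : a.sum + b.sum + (a.length + 4 * b.length) = n := by
  rw [← sum_biletters14, ← h, map_biletters, p.parts_sum]

theorem exists_biletters_eq {n : ℕ} (p : Partitions14 n) :
    ∃ a b : List ℕ, a.Pairwise (· ≤ ·) ∧ b.Pairwise (· ≤ ·) ∧
      biletters p.1 = biletters14 a b ∧ ∀ x ∈ a ++ b, x ≡ 0 [MOD 5] := by
  obtain ⟨a, b, ha, hb, h⟩ := exists_biletters14 (biletters p.1) (by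
    intro c hc
    obtain ⟨m, hm, rfl⟩ := Multiset.mem_map.1 hc
    exact p.2 m hm)
  refine ⟨a, b, ha, hb, h, fun x hx => ?_⟩
  have hc : ∃ k, toLex (k, x) ∈ biletters p.1 := by
    rw [h]
    rcases List.mem_append.1 hx with hx | hx
    · exact ⟨1, mem_biletters14.2 (Or.inl ⟨x, hx, rfl⟩)⟩
    · exact ⟨4, mem_biletters14.2 (Or.inr ⟨x, hx, rfl⟩)⟩
  obtain ⟨k, hk⟩ := hc
  obtain ⟨m, -, hm⟩ := Multiset.mem_map.1 hk
  rw [← (Prod.mk.inj (toLex.injective hm)).2]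
  exact (Nat.modEq_zero_iff_dvd).2 ⟨_, rfl⟩

theorem exists_partition {n : ℕ} {a b : List ℕ} (h5 : ∀ x ∈ a ++ b, x ≡ 0 [MOD 5])
    (hn : a.sum + b.sum + (a.length + 4 * b.length) = n) :
    ∃ p : Partitions14 n, biletters p.1 = biletters14 a b := by
  have hmem : ∀ c ∈ biletters14 a b,
      ((ofLex c).1 = 1 ∨ (ofLex c).1 = 4) ∧ (ofLex c).2 % 5 = 0 := by
    intro c hc
    rcases mem_biletters14.1 hc with ⟨x, hx, rfl⟩ | ⟨x, hx, rfl⟩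
    · exact ⟨Or.inl rfl, h5 x (by simp [hx])⟩
    · exact ⟨Or.inr rfl, h5 x (by simp [hx])⟩
  refine ⟨⟨⟨(biletters14 a b).map fun c => (ofLex c).2 + (ofLex c).1, ?_, ?_⟩, ?_⟩, ?_⟩
  · intro m hm
    obtain ⟨c, hc, rfl⟩ := Multiset.mem_map.1 hm
    -- Parts are positive even over the bottom 0, because the top is 1 or 4.
    have := (hmem c hc).1
    omega
  · rw [sum_biletters14, hn]
  · intro m hm
    change m ∈ (biletters14 a b).map _ at hm
    obtain ⟨c, hc, rfl⟩ := Multiset.mem_map.1 hm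
    have := hmem c hc
    simp only [Nat.ModEq]
    omega
  · rw [biletters, Multiset.map_map]
    conv_rhs => rw [← Multiset.map_id (biletters14 a b)]
    refine Multiset.map_congr rfl fun c hc => ?_
    have := hmem c hc
    have h1 : ((ofLex c).2 + (ofLex c).1) % 5 = (ofLex c).1 := by omega
    have h2 : 5 * (((ofLex c).2 + (ofLex c).1) / 5) = (ofLex c).2 := by omega
    simp only [Function.comp_apply, h1, h2]
    rfl

/-! ### The bijection -/

theorem exists_tableauPair_rows (n : ℕ) {r s q t : List ℕ} (hr : r.Pairwise (· ≤ ·))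
    (hs : s.Pairwise (· ≤ ·)) (hq : q.Pairwise (· ≤ ·)) (ht : t.Pairwise (· ≤ ·))
    (hle : s.length ≤ r.length) (hqr : q.length = r.length) (hts : t.length = s.length)
    (hP : ∀ i < s.length, r.getD i 0 < s.getD i 0)
    (hQ : ∀ i < t.length, q.getD i 0 < t.getD i 0)
    (h5 : ∀ x ∈ r ++ s, x ≡ 0 [MOD 5]) (h14 : ∀ x ∈ q ++ t, x = 1 ∨ x = 4)
    (hn : r.sum + s.sum + (q.sum + t.sum) = n) :
    ∃ T : TableauPair n, rows T.P = twoRows r s ∧ rows T.Q = twoRows q t := by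
  have hμ := colLen_twoRowDiagram_le hle
  obtain ⟨P, hP₀, hP₁⟩ := exists_tableau hle hr hs rfl rfl hP
  obtain ⟨Q, hQ₀, hQ₁⟩ := exists_tableau hle hq ht hqr hts hQ
  simp only [List.mem_append, or_imp, forall_and] at h5 h14
  exact ⟨⟨_, P, Q, hμ, (forall_cells P hμ (· ≡ 0 [MOD 5])).2 (by rwa [hP₀, hP₁]),
    (forall_cells Q hμ fun x => x = 1 ∨ x = 4).2 (by rwa [hQ₀, hQ₁]), by
      rw [sum_cells P hμ, sum_cells Q hμ, hP₀, hP₁, hQ₀, hQ₁, hn]⟩,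
    by rw [rows_eq_twoRows P hμ, hP₀, hP₁], by rw [rows_eq_twoRows Q hμ, hQ₀, hQ₁]⟩

theorem exists_rows_eq_rsk {n : ℕ} (p : Partitions14 n) :
    ∃ T : TableauPair n, (rows T.P, rows T.Q) = rsk (biletters p.1) := by
  obtain ⟨a, b, ha, hb, hp, h5⟩ := exists_biletters_eq p
  obtain ⟨r, s, h⟩ := Inserts.exists_of_pairwise a hb
  have hlen := h.length_le
  have hlen' := h.length_snd_le_row ha
  have hsum : r.sum + s.sum = a.sum + b.sum := by simpa using h.perm.sum_eq
  have hadd := h.length_add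
  obtain ⟨T, hP, hQ⟩ := exists_tableauPair_rows n
    (q := List.replicate a.length 1 ++ List.replicate (r.length - a.length) 4)
    (t := List.replicate s.length 4) (h.pairwise_fst ha) (h.pairwise_snd ha)
    (by simp [List.pairwise_append, List.pairwise_replicate])
    (by simp [List.pairwise_replicate]) (hlen'.trans hlen) (by simp; omega) (by simp)
    (h.column_strict ha) (by
      intro i hi
      rw [List.length_replicate] at hi
      rw [List.getD_append _ _ _ _ (by simp; omega), List.getD_replicate _ (by omega),
        List.getD_replicate _ hi]
      norm_num) (fun x hx => h5 x (h.perm.mem_iff.1 hx))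
    (by
      intro x hx
      simp only [List.mem_append, List.mem_replicate] at hx
      omega)
    (by
      rw [← sum_of_biletters_eq hp, hsum]
      simp only [List.sum_append, List.sum_replicate, smul_eq_mul]
      omega)
  exact ⟨T, by rw [hP, hQ, hp, h.rsk_eq ha]⟩

theorem rsk_biletters_injective {n : ℕ} :
    Function.Injective fun p : Partitions14 n => rsk (biletters p.1) := by
  intro p p' heq
  simp only at heq
  obtain ⟨a, b, ha, hb, hp, -⟩ := exists_biletters_eq p
  obtain ⟨a', b', ha', hb', hp', -⟩ := exists_biletters_eq p'
  obtain ⟨r, s, h⟩ := Inserts.exists_of_pairwise a hb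
  obtain ⟨r', s', h'⟩ := Inserts.exists_of_pairwise a' hb'
  have h1 := h.length_le
  have h2 := h.length_snd_le_row ha
  have h1' := h'.length_le
  have h2' := h'.length_snd_le_row ha'
  rw [hp, hp', h.rsk_eq ha, h'.rsk_eq ha', Prod.mk.injEq] at heq
  obtain ⟨rfl, rfl⟩ := twoRows_injective (by omega) (by omega) heq.1
  have h3 := (twoRows_injective (by simp; omega) (by simp; omega) heq.2).1
  -- The number of 1's in the first row of Q recovers the length of the initial row.
  have hlen : a.length = a'.length := by
    simpa [List.count_append, List.count_replicate] using congrArg (List.count 1) h3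
  obtain ⟨rfl, rfl⟩ := h.injective h' ha ha' hlen
  exact Subtype.ext (biletters_injective (hp.trans hp'.symm))

theorem exists_replicate_append {q : List ℕ} (hq : q.Pairwise (· ≤ ·))
    (h : ∀ x ∈ q, x = 1 ∨ x = 4) :
    ∃ k l, q = List.replicate k 1 ++ List.replicate l 4 := by
  induction q with
  | nil => exact ⟨0, 0, rfl⟩
  | cons x q ih =>
    rw [List.pairwise_cons] at hq
    rcases h x (by simp) with rfl | rfl
    · obtain ⟨k, l, rfl⟩ := ih hq.2 fun x hx => h x (by simp [hx])
      exact ⟨k + 1, l, rfl⟩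
    · refine ⟨0, q.length + 1, ?_⟩
      rw [List.replicate_zero, List.nil_append, List.eq_replicate_iff]
      refine ⟨rfl, fun x hx => ?_⟩
      rcases List.mem_cons.1 hx with rfl | hx'
      · rfl
      · have := hq.1 x hx'
        have := h x hx
        omega

theorem exists_rsk_eq_rows {n : ℕ} (T : TableauPair n) :
    ∃ p : Partitions14 n, rsk (biletters p.1) = (rows T.P, rows T.Q) := by
  obtain ⟨μ, P, Q, hμ, hP, hQ, hn⟩ := T
  simp only
  rw [forall_cells P hμ (· ≡ 0 [MOD 5])] at hP
  rw [forall_cells Q hμ fun x => x = 1 ∨ x = 4] at hQ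
  rw [sum_cells P hμ, sum_cells Q hμ] at hn
  rw [rows_eq_twoRows P hμ, rows_eq_twoRows Q hμ]
  obtain ⟨k, l, hkl⟩ := exists_replicate_append (pairwise_rowList Q 0) hQ.1
  have hcol := fun i => getD_rowList_lt Q (i := i)
  have hlen0 : (rowList P 0).length = k + l := by
    simpa using (congrArg List.length hkl)
  have hlen1 : (rowList Q 1).length = (rowList P 1).length := by simp
  -- A 1 in the second row would need a smaller entry above it.
  have ht : rowList Q 1 = List.replicate (rowList P 1).length 4 := by
    refine List.eq_replicate_iff.2 ⟨hlen1, fun x hx => (hQ.2 x hx).resolve_left ?_⟩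
    rintro rfl
    obtain ⟨i, hi, h1⟩ := List.getElem_of_mem hx
    have h2 := hcol i hi
    rw [List.getD_eq_getElem _ _ hi, h1] at h2
    have hi' := hi.trans_le (length_rowList_le Q)
    rw [List.getD_eq_getElem _ _ hi'] at h2
    have := hQ.1 _ (List.getElem_mem hi')
    omega
  -- Otherwise column k (counted from 0) of Q would have a 4 above a 4.
  have hk : (rowList P 1).length ≤ k := by
    by_contra hlt
    have h2 := hcol k (by omega)
    have := length_rowList_le P
    rw [hkl, ht, List.getD_append_right _ _ _ _ (by simp), List.getD_replicate _ (by simp; omega),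
      List.getD_replicate _ (by omega)] at h2
    exact lt_irrefl _ h2
  obtain ⟨a, b, ha, hak, h⟩ := Inserts.exists_of_column_strict (pairwise_rowList P 0)
    (pairwise_rowList P 1) hk (by omega) fun i => getD_rowList_lt P
  have hadd := h.length_add
  have hsum : (rowList P 0).sum + (rowList P 1).sum = a.sum + b.sum := by
    simpa using h.perm.sum_eq
  obtain ⟨p, hp⟩ := exists_partition (n := n) (a := a) (b := b) (fun x hx => by
      rcases List.mem_append.1 (h.perm.mem_iff.2 hx) with hx | hx
      · exact hP.1 x hx
      · exact hP.2 x hx) (by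
      rw [← hn, hkl, ht, hsum]
      simp only [List.sum_append, List.sum_replicate, smul_eq_mul]
      omega)
  refine ⟨p, ?_⟩
  rw [hp, h.rsk_eq ha, hkl, ht, hak, hlen0, Nat.add_sub_cancel_left]

end RSK

theorem proposition2p2 (n : ℕ) :
    ∃ f : RSK.Partitions14 n → RSK.TableauPair n,
      Function.Bijective f ∧
        ∀ p : RSK.Partitions14 n,
          (RSK.rows (f p).P, RSK.rows (f p).Q) = RSK.rsk (RSK.biletters p.1) := by
  choose f hf using fun p : RSK.Partitions14 n => RSK.exists_rows_eq_rsk p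
  refine ⟨f, ⟨fun p p' h => RSK.rsk_biletters_injective ?_, fun T => ?_⟩, hf⟩
  · simp only [← hf]
    rw [h]
  · obtain ⟨p, hp⟩ := RSK.exists_rsk_eq_rows T
    have h := (hf p).trans hp
    exact ⟨p, RSK.TableauPair.eq_of_rows_eq (congrArg Prod.fst h) (congrArg Prod.snd h)⟩
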